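/- For a Noetherian local ring $(A,\mathfrak m)$ of characteristic $p>0$ and dimension $d$, let $e_{HK}(A)=\lim_{q=p^e\to\infty}\lambda(A/\mathfrak m^{[q]})/q^d$ denote its Hilbert–Kunz multiplicity, where $\lambda$ is length and $\mathfrak m^{[q]}=(a^q : a\in\mathfrak m)$. Call a real function $F$ on a topological space $T$ dense upper semicontinuous if every $x\in T$ lies in a dense subset $U\subset T$ with $F(y)\le F(x)$ for all $y\in U$. Let $k$ be an uncountable algebraically closed field of characteristic $p>0$. Let $f,g\in k[[x_1,\dots,x_n]]$ with $f\neq 0$, $f(0)=0$ (so that $k[[x_1,\dots,x_n]]/(f)$ is an $(n-1)$-dimensional hypersurface ring) and $g\ne 0$, $g(0)=0$, $g\notin k\cdot f$. Put $R=k[[x_1,\dots,x_n]][t]/(f+tg)$ and, for $\alpha\in k$, $t_\alpha=t-\alpha$ and $\mathfrak m_\alpha=(x_1,\dots,x_n,t-\alpha)\subset R$, a maximal ideal. Equip $k$ with the Zariski topology, identifying $\alpha$ with the closed point $(t-\alpha)$ of $\operatorname{Spec} k[t]$. Then the limits defining the Hilbert–Kunz multiplicities below exist, and: (1) There is a dense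 subset $\Lambda\subset k$ containing $0$ such that for every $\alpha\in\Lambda$ $$e_{HK}\big((R/t_\alpha R)_{\mathfrak m_\alpha}\big)=e_{HK}\Big(\frac{k[[x_1,\dots,x_n]]}{(f+\alpha g)}\Big)\le e_{HK}\big((R/tR)_{\mathfrak m_0}\big)=e_{HK}\Big(\frac{k[[x_1,\dots,x_n]]}{(f)}\Big).$$ (2) The function $\alpha\mapsto e_{HK}\big((R/t_\alpha R)_{\mathfrak m_\alpha}\big)$ on $k$ is dense upper semicontinuous; that is, $e_{HK}$ is dense upper semicontinuous in the fibers of $k[t]\to R$ over the maximal ideals of $k[t]$. -/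

import Mathlib

open Filter Topology

noncomputable section

/-! ### Hilbert–Kunz multiplicity -/

/-- The ideal `I^{[q]} = (i^q : i ∈ I)`. -/
def bracketPower {A : Type*} [CommRing A] (I : Ideal A) (q : ℕ) : Ideal A :=
  Ideal.span ((fun a : A => a ^ q) '' (I : Set A))

/-- The Krull dimension as a natural number (it is finite for Noetherian local rings). -/
def krullDimNat (A : Type*) [CommRing A] : ℕ :=
  ((ringKrullDim A).unbotD 0).toNat

/-- The sequence `e ↦ λ(A / 𝔪^{[p^e]}) / (p^e)^d` of a local ring `(A, 𝔪)` of dimension `d`. -/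
def hkSeq (p : ℕ) (A : Type*) [CommRing A] [IsLocalRing A] (e : ℕ) : ℝ :=
  ((Module.length A (A ⧸ bracketPower (IsLocalRing.maximalIdeal A) (p ^ e))).toNat : ℝ) /
    ((p : ℝ) ^ e) ^ krullDimNat A

/-- The Hilbert–Kunz multiplicity `e_HK(A) = lim λ(A / 𝔪^{[q]}) / q^d`, `q = p^e → ∞`, of a local
ring `(A, 𝔪)` of characteristic `p` and dimension `d`. -/
def eHK (p : ℕ) (A : Type*) [CommRing A] [IsLocalRing A] : ℝ :=
  limUnder atTop (hkSeq p A)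

/-- The limit that defines `e_HK(A)` exists. -/
def HKConverges (p : ℕ) (A : Type*) [CommRing A] [IsLocalRing A] : Prop :=
  ∃ l : ℝ, Tendsto (hkSeq p A) atTop (𝓝 l)

/-! ### Dense upper semicontinuity -/

/-- Every point `x` lies in a dense set `U` such that `F y ≤ F x` for all `y ∈ U`. -/
def DenseUpperSemicontinuous {T : Type*} [TopologicalSpace T] (F : T → ℝ) : Prop :=
  ∀ x : T, ∃ U : Set T, Dense U ∧ x ∈ U ∧ ∀ y ∈ U, F y ≤ F x

/-- The closed point `(t - α)` of `Spec k[t]`. -/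
def linePoint (k : Type*) [Field k] (α : k) : PrimeSpectrum (Polynomial k) :=
  ⟨Ideal.span {Polynomial.X - Polynomial.C α},
    (Ideal.span_singleton_prime (Polynomial.X_sub_C_ne_zero α)).2 (Polynomial.prime_X_sub_C α)⟩

/-- The Zariski topology on `k`, where `α ∈ k` is viewed as the point `(t - α)` of `Spec k[t]`. -/
abbrev zariskiLine (k : Type*) [Field k] : TopologicalSpace k :=
  TopologicalSpace.induced (linePoint k) PrimeSpectrum.zariskiTopology

/-! ### The family of hypersurfaces -/

/-- A pencil `f + t g`: `f` defines an `(n-1)`-dimensional hypersurface in `k[[x_1,…,x_n]]`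
(that is, `f ≠ 0` and `f(0) = 0`), and `g ≠ 0`, `g(0) = 0`, `g ∉ k · f`. -/
structure HypersurfacePencil (k : Type*) [Field k] (n : ℕ) where
  f : MvPowerSeries (Fin n) k
  g : MvPowerSeries (Fin n) k
  f_ne_zero : f ≠ 0
  f_zero : MvPowerSeries.constantCoeff f = 0
  g_ne_zero : g ≠ 0
  g_zero : MvPowerSeries.constantCoeff g = 0
  g_not_mem : ∀ c : k, g ≠ c • f

/-- The ring `k[[x_1,…,x_n]]/(h)`. -/
abbrev HypersurfaceRing {k : Type*} [Field k] {n : ℕ} (h : MvPowerSeries (Fin n) k) : Type _ :=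
  MvPowerSeries (Fin n) k ⧸ Ideal.span {h}

theorem hypersurfaceRing_isLocalRing {k : Type*} [Field k] {n : ℕ} {h : MvPowerSeries (Fin n) k}
    (hh : MvPowerSeries.constantCoeff h = 0) : IsLocalRing (HypersurfaceRing h) := by
  have hne : Ideal.span {h} ≠ ⊤ := by
    intro hs
    have hu : IsUnit h := Ideal.span_singleton_eq_top.1 hs
    have := hu.map (MvPowerSeries.constantCoeff (σ := Fin n) (R := k))
    rw [hh] at this
    exact not_isUnit_zero this
  have : Nontrivial (HypersurfaceRing h) := Ideal.Quotient.nontrivial_iff.2 hne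
  exact IsLocalRing.of_surjective' (Ideal.Quotient.mk (Ideal.span {h})) Ideal.Quotient.mk_surjective

/-- A power series without constant term lies in `(x_1,…,x_n)`. -/
theorem mem_span_X_of_constantCoeff_eq_zero {k : Type*} [Field k] {n : ℕ}
    (h : MvPowerSeries (Fin n) k) (hh : MvPowerSeries.constantCoeff h = 0) :
    h ∈ Ideal.span (Set.range (fun i : Fin n => (MvPowerSeries.X i : MvPowerSeries (Fin n) k))) := by
  classical
  have hex : ∀ m : Fin n →₀ ℕ, m ≠ 0 → ∃ i, m i ≠ 0 := fun m hm => by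
    by_contra hc
    push Not at hc
    exact hm (Finsupp.ext hc)
  let s : (Fin n →₀ ℕ) → Fin n → Prop := fun m i => ∃ hm : m ≠ 0, (hex m hm).choose = i
  let q : Fin n → MvPowerSeries (Fin n) k := fun i m =>
    if s (m + Finsupp.single i 1) i then MvPowerSeries.coeff (m + Finsupp.single i 1) h else 0
  have key : h = ∑ i, MvPowerSeries.X i * q i := by
    ext m
    rw [map_sum]
    have hterm : ∀ i, MvPowerSeries.coeff m (MvPowerSeries.X i * q i) =
        if s m i then MvPowerSeries.coeff m h else 0 := by
      intro i
      rw [MvPowerSeries.X_def, MvPowerSeries.coeff_monomial_mul]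
      by_cases hi : Finsupp.single i 1 ≤ m
      · rw [if_pos hi, one_mul]
        change (if s (m - Finsupp.single i 1 + Finsupp.single i 1) i then _ else _) = _
        rw [tsub_add_cancel_of_le hi]
      · rw [if_neg hi, if_neg]
        rintro ⟨hm, hc⟩
        apply hi
        have := (hex m hm).choose_spec
        rw [hc] at this
        rw [Finsupp.single_le_iff]
        omega
    simp only [hterm]
    by_cases hm : m = 0
    · subst hm
      have hz : MvPowerSeries.coeff 0 h = 0 := hh
      simp [hz]
    · rw [Finset.sum_eq_single (hex m hm).choose]
      · rw [if_pos ⟨hm, rfl⟩]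
      · intro i _ hi
        rw [if_neg]
        rintro ⟨_, hc⟩
        exact hi hc.symm
      · intro hc
        exact absurd (Finset.mem_univ _) hc
  rw [key]
  exact Ideal.sum_mem _ fun i _ =>
    Ideal.mul_mem_right _ _ (Ideal.subset_span ⟨i, rfl⟩)

namespace HypersurfacePencil

variable {k : Type*} [Field k] {n : ℕ} (P : HypersurfacePencil k n)

/-- The member `f + α g` of the pencil. -/
abbrev member (α : k) : MvPowerSeries (Fin n) k := P.f + α • P.g

theorem member_zero (α : k) : MvPowerSeries.constantCoeff (P.member α) = 0 := by
  simp [member, P.f_zero, P.g_zero, MvPowerSeries.smul_eq_C_mul]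

instance : IsLocalRing (HypersurfaceRing P.f) := hypersurfaceRing_isLocalRing P.f_zero

instance (α : k) : IsLocalRing (HypersurfaceRing (P.member α)) :=
  hypersurfaceRing_isLocalRing (P.member_zero α)

/-- The element `f + t g` of `k[[x_1,…,x_n]][t]`. -/
abbrev equation : Polynomial (MvPowerSeries (Fin n) k) :=
  Polynomial.C P.f + Polynomial.X * Polynomial.C P.g

/-- The ring `R = k[[x_1,…,x_n]][t]/(f + t g)`. -/
def TotalRing : Type _ :=
  Polynomial (MvPowerSeries (Fin n) k) ⧸ Ideal.span {P.equation}

instance : CommRing P.TotalRing :=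
  inferInstanceAs (CommRing (Polynomial (MvPowerSeries (Fin n) k) ⧸ Ideal.span {P.equation}))

/-- The quotient map `k[[x_1,…,x_n]][t] → R`. -/
def toTotal : Polynomial (MvPowerSeries (Fin n) k) →+* P.TotalRing :=
  Ideal.Quotient.mk (Ideal.span {P.equation})

theorem toTotal_surjective : Function.Surjective P.toTotal :=
  Ideal.Quotient.mk_surjective

/-- The image of `x_i` in `R`. -/
def x (i : Fin n) : P.TotalRing :=
  P.toTotal (Polynomial.C (MvPowerSeries.X i))

/-- The element `t_α = t - α` of `R`. -/
def tSub (α : k) : P.TotalRing :=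
  P.toTotal (Polynomial.X - Polynomial.C (MvPowerSeries.C α))

/-- The ideal `𝔪_α = (x_1,…,x_n, t - α)` of `R`. -/
def maxIdeal (α : k) : Ideal P.TotalRing :=
  Ideal.span (Set.range P.x ∪ {P.tSub α})

/-- The ring `R/(t_α)`, the fiber of `k[t] → R` over the point `(t - α)`. -/
abbrev Fiber (α : k) : Type _ := P.TotalRing ⧸ Ideal.span {P.tSub α}

/-- The image of `𝔪_α` in `R/(t_α)`. -/
def fiberMaxIdeal (α : k) : Ideal (P.Fiber α) :=
  (P.maxIdeal α).map (Ideal.Quotient.mk (Ideal.span {P.tSub α}))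

instance maxIdeal_isMaximal (α : k) : (P.maxIdeal α).IsMaximal := by
  let ev : Polynomial (MvPowerSeries (Fin n) k) →+* k :=
    Polynomial.eval₂RingHom (MvPowerSeries.constantCoeff (σ := Fin n) (R := k)) α
  have heq : ∀ a ∈ Ideal.span {P.equation}, ev a = 0 := by
    intro a ha
    obtain ⟨b, rfl⟩ := Ideal.mem_span_singleton'.1 ha
    simp [ev, P.f_zero, P.g_zero]
  let φ : P.TotalRing →+* k := Ideal.Quotient.lift _ ev heq
  have hφev : ∀ b, φ (P.toTotal b) = ev b := fun b => rfl
  have hφ : Function.Surjective φ := fun c =>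
    ⟨P.toTotal (Polynomial.C (MvPowerSeries.C c)), by simp [hφev, ev]⟩
  have hker : RingHom.ker φ = P.maxIdeal α := by
    apply le_antisymm
    · intro a ha
      obtain ⟨b, rfl⟩ := P.toTotal_surjective a
      have hb : ev b = 0 := ha
      obtain ⟨c, hc⟩ := Polynomial.X_sub_C_dvd_sub_C_eval (a := MvPowerSeries.C α) (p := b)
      have hb' : b = (Polynomial.X - Polynomial.C (MvPowerSeries.C α)) * c +
          Polynomial.C (Polynomial.eval (MvPowerSeries.C α) b) := by rw [← hc]; ring
      have h0 : MvPowerSeries.constantCoeff (Polynomial.eval (MvPowerSeries.C α) b) = 0 := by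
        rw [hb'] at hb
        simpa [ev] using hb
      have hmem := mem_span_X_of_constantCoeff_eq_zero _ h0
      have h1 : P.toTotal
          (Polynomial.C (Polynomial.eval (MvPowerSeries.C α) b)) ∈ P.maxIdeal α := by
        have := Ideal.mem_map_of_mem
          (P.toTotal.comp Polynomial.C) hmem
        rw [Ideal.map_span] at this
        refine Ideal.span_mono ?_ this
        rintro _ ⟨_, ⟨i, rfl⟩, rfl⟩
        exact Or.inl ⟨i, rfl⟩
      rw [hb', map_add, map_mul]
      exact Ideal.add_mem _ (Ideal.mul_mem_right _ _ (Ideal.subset_span (Or.inr rfl))) h1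
    · rw [maxIdeal, Ideal.span_le]
      rintro _ (⟨i, rfl⟩ | rfl)
      · simp [x, hφev, ev]
      · simp [tSub, hφev, ev]
  rw [← hker]
  exact RingHom.ker_isMaximal_of_surjective φ hφ

instance fiberMaxIdeal_isMaximal (α : k) : (P.fiberMaxIdeal α).IsMaximal := by
  refine Ideal.IsMaximal.map_of_surjective_of_ker_le Ideal.Quotient.mk_surjective ?_
  rw [Ideal.mk_ker, Ideal.span_le, Set.singleton_subset_iff]
  exact Ideal.subset_span (Or.inr rfl)

/-- The local ring `(R/t_α)_{𝔪_α}`. -/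
abbrev LocalFiber (α : k) : Type _ := Localization.AtPrime (P.fiberMaxIdeal α)

end HypersurfacePencil

end

/-! Setting `t = α` identifies the fiber with `k[[x]]/(f + αg)`. This ring is already local, so the
localization changes nothing. Over `k` the lengths become `colength h q = dim k[[x]]/(h,
x_1^q,…,x_n^q)`, which equals `q^n` minus the rank of multiplication by `h` on
`k[[x]]/(x_1^q,…,x_n^q)`. For `h = f + αg` this operator is affine in `α`, so its rank falls below
the rank at a given `α₀` for only finitely many `α` (`LinearMap.finite_setOf_finrank_range_lt`).
Over all `q = p^e` countably many parameters are lost, and a set with countable complement in an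
uncountable field is Zariski dense. On it all lengths are at most those at `α₀`, hence so are the
limits.

The limits exist because `colength h q / q^(n-1)` is monotone along `q = p^e` and bounded.
Monotonicity combines `p^n * colength h q ≤ colength (h^p) (pq)`, proved with Cartier operators, and
`colength (h^p) (pq) ≤ p * colength h (pq)`. Boundedness comes from the lexicographic leading term
of `h` (`exists_colength_le`). -/

noncomputable section

/-! ### Truncated power series rings and the bound on colengths. -/

namespace MvPowerSeries

variable {k : Type*} [Field k] {n : ℕ}

/-- The ideal `(x_1^q,…,x_n^q)`. -/
def varPowIdeal (k : Type*) [Field k] (n q : ℕ) : Ideal (MvPowerSeries (Fin n) k) :=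
  Ideal.span (Set.range fun i : Fin n => (X i : MvPowerSeries (Fin n) k) ^ q)

theorem X_pow_mem_varPowIdeal (q : ℕ) (i : Fin n) :
    (X i : MvPowerSeries (Fin n) k) ^ q ∈ varPowIdeal k n q :=
  Ideal.subset_span ⟨i, rfl⟩

theorem mem_varPowIdeal_iff {q : ℕ} {s : MvPowerSeries (Fin n) k} :
    s ∈ varPowIdeal k n q ↔ ∀ m : Fin n →₀ ℕ, (∀ i, m i < q) → coeff m s = 0 := by
  classical
  constructor
  · intro hs
    induction hs using Submodule.span_induction with
    | mem x hx =>
      obtain ⟨i, rfl⟩ := hx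
      exact fun m hm => X_pow_dvd_iff.1 dvd_rfl m (hm i)
    | zero => simp
    | add x y _ _ hx hy => exact fun m hm => by rw [map_add, hx m hm, hy m hm, add_zero]
    | smul a x _ hx =>
      intro m hm
      rw [smul_eq_mul, coeff_mul]
      refine Finset.sum_eq_zero fun uv huv => ?_
      rw [Finset.HasAntidiagonal.mem_antidiagonal] at huv
      have hle : uv.2 ≤ m := huv ▸ le_add_self
      rw [hx uv.2 fun i => (hle i).trans_lt (hm i), mul_zero]
  · intro h
    -- Each exponent outside the box is assigned to a single variable whose power divides it, so `s`
    -- splits into `n` pieces with disjoint supports.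
    let c : (Fin n →₀ ℕ) → Fin n → Prop := fun m i => ∃ h : ∃ j, q ≤ m j, h.choose = i
    let t : Fin n → MvPowerSeries (Fin n) k := fun i m => if c m i then coeff m s else 0
    have ht : ∀ i m, coeff m (t i) = if c m i then coeff m s else 0 := fun i m => rfl
    have hs : s = ∑ i, t i := by
      ext m
      rw [map_sum]
      simp only [ht]
      by_cases hm : ∃ j, q ≤ m j
      · rw [Finset.sum_eq_single_of_mem hm.choose (Finset.mem_univ _), if_pos ⟨hm, rfl⟩]
        rintro i - hi
        rw [if_neg]
        rintro ⟨_, hc⟩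
        exact hi hc.symm
      · rw [h m (by simpa using hm), Finset.sum_eq_zero]
        intro i _
        simp
    rw [hs]
    refine Ideal.sum_mem _ fun i _ => Ideal.mem_of_dvd _ ?_ (X_pow_mem_varPowIdeal q i)
    rw [X_pow_dvd_iff]
    intro m hm
    rw [ht, if_neg]
    rintro ⟨hj, rfl⟩
    exact absurd hj.choose_spec (not_le.2 hm)

/-- The exponent vector of a point of the box `{0,…,q-1}^n`. -/
def boxExp {q : ℕ} (v : Fin n → Fin q) : Fin n →₀ ℕ :=
  Finsupp.equivFunOnFinite.symm fun i => (v i : ℕ)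

@[simp] theorem boxExp_apply {q : ℕ} (v : Fin n → Fin q) (i : Fin n) : boxExp v i = v i := rfl

theorem boxExp_injective {q : ℕ} : Function.Injective (boxExp (n := n) (q := q)) := fun _ _ h =>
  funext fun i => Fin.ext (DFunLike.congr_fun h i)

theorem exists_boxExp_eq {q : ℕ} {m : Fin n →₀ ℕ} (hm : ∀ i, m i < q) :
    ∃ v : Fin n → Fin q, boxExp v = m :=
  ⟨fun i => ⟨m i, hm i⟩, Finsupp.ext fun _ => rfl⟩

/-- The coefficients of a power series with exponents in the box `{0,…,q-1}^n`. -/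
def boxCoeff (k : Type*) [Field k] (n q : ℕ) :
    MvPowerSeries (Fin n) k →ₗ[k] ((Fin n → Fin q) → k) :=
  LinearMap.pi fun v => coeff (boxExp v)

@[simp] theorem boxCoeff_apply {q : ℕ} (s : MvPowerSeries (Fin n) k) (v : Fin n → Fin q) :
    boxCoeff k n q s v = coeff (boxExp v) s := rfl

/-- The polynomial with given coefficients in the box `{0,…,q-1}^n`. -/
def boxSeries (k : Type*) [Field k] (n q : ℕ) :
    ((Fin n → Fin q) → k) →ₗ[k] MvPowerSeries (Fin n) k :=
  Fintype.linearCombination k fun v : Fin n → Fin q => monomial (boxExp v) (1 : k)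

theorem coeff_boxSeries {q : ℕ} (u : (Fin n → Fin q) → k) (m : Fin n →₀ ℕ) :
    coeff m (boxSeries k n q u) = ∑ v, u v * (if m = boxExp v then 1 else 0) := by
  classical
  simp [boxSeries, Fintype.linearCombination_apply, coeff_monomial]

theorem boxCoeff_boxSeries {q : ℕ} (u : (Fin n → Fin q) → k) :
    boxCoeff k n q (boxSeries k n q u) = u := by
  classical
  ext v
  simp [coeff_boxSeries, boxExp_injective.eq_iff]

theorem boxCoeff_surjective (q : ℕ) : Function.Surjective (boxCoeff k n q) := fun u =>
  ⟨_, boxCoeff_boxSeries u⟩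

theorem ker_boxCoeff (q : ℕ) :
    LinearMap.ker (boxCoeff k n q) = (varPowIdeal k n q).restrictScalars k := by
  ext s
  rw [LinearMap.mem_ker, Submodule.restrictScalars_mem, mem_varPowIdeal_iff]
  constructor
  · intro h m hm
    obtain ⟨v, rfl⟩ := exists_boxExp_eq hm
    exact congrFun h v
  · intro h
    ext v
    exact h _ fun i => (v i).2

/-- `k[[x_1,…,x_n]]/(x_1^q,…,x_n^q)` has the monomials in the box `{0,…,q-1}^n` as a basis. -/
def quotientVarPowIdealEquiv (k : Type*) [Field k] (n q : ℕ) :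
    (MvPowerSeries (Fin n) k ⧸ varPowIdeal k n q) ≃ₗ[k] ((Fin n → Fin q) → k) :=
  (Submodule.Quotient.restrictScalarsEquiv k (varPowIdeal k n q)).symm ≪≫ₗ
    Submodule.quotEquivOfEq _ _ (ker_boxCoeff q).symm ≪≫ₗ
    (boxCoeff k n q).quotKerEquivOfSurjective (boxCoeff_surjective q)

instance (q : ℕ) : Module.Finite k (MvPowerSeries (Fin n) k ⧸ varPowIdeal k n q) :=
  Module.Finite.equiv (quotientVarPowIdealEquiv k n q).symm

theorem finrank_quotient_varPowIdeal (q : ℕ) :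
    Module.finrank k (MvPowerSeries (Fin n) k ⧸ varPowIdeal k n q) = q ^ n := by
  simp [(quotientVarPowIdealEquiv k n q).finrank_eq]

theorem finite_quotient_of_varPowIdeal_le {q : ℕ} {I : Ideal (MvPowerSeries (Fin n) k)}
    (h : varPowIdeal k n q ≤ I) : Module.Finite k (MvPowerSeries (Fin n) k ⧸ I) :=
  Module.Finite.of_surjective (Ideal.Quotient.factorₐ k h).toLinearMap
    (Ideal.Quotient.factor_surjective h)

/-- The `k`-dimension of `k[[x_1,…,x_n]]/(h, x_1^q,…,x_n^q)`. -/
def colength (h : MvPowerSeries (Fin n) k) (q : ℕ) : ℕ :=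
  Module.finrank k (MvPowerSeries (Fin n) k ⧸ (Ideal.span {h} ⊔ varPowIdeal k n q))

instance (h : MvPowerSeries (Fin n) k) (q : ℕ) :
    Module.Finite k (MvPowerSeries (Fin n) k ⧸ (Ideal.span {h} ⊔ varPowIdeal k n q)) :=
  finite_quotient_of_varPowIdeal_le le_sup_right

/-- Multiplication by `h` on `k[[x_1,…,x_n]]/(x_1^q,…,x_n^q)`. -/
def mulTrunc (h : MvPowerSeries (Fin n) k) (q : ℕ) :
    (MvPowerSeries (Fin n) k ⧸ varPowIdeal k n q) →ₗ[k]
      (MvPowerSeries (Fin n) k ⧸ varPowIdeal k n q) :=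
  LinearMap.mulLeft k (Ideal.Quotient.mk (varPowIdeal k n q) h)

theorem mulTrunc_mk (h s : MvPowerSeries (Fin n) k) (q : ℕ) :
    mulTrunc h q (Ideal.Quotient.mk _ s) = Ideal.Quotient.mk (varPowIdeal k n q) (h * s) := rfl

theorem mulTrunc_add_smul (f g : MvPowerSeries (Fin n) k) (α : k) (q : ℕ) :
    mulTrunc (f + α • g) q = mulTrunc f q + α • mulTrunc g q := by
  refine LinearMap.ext fun s => ?_
  obtain ⟨s, rfl⟩ := Ideal.Quotient.mk_surjective s
  rw [LinearMap.add_apply, LinearMap.smul_apply, mulTrunc_mk, mulTrunc_mk, mulTrunc_mk, add_mul,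
    smul_mul_assoc, map_add]
  rfl

/-- The cokernel of multiplication by `h` is the quotient by `(h, x_1^q,…,x_n^q)`. This turns
statements about colengths into statements about ranks. -/
theorem colength_add_finrank_range (h : MvPowerSeries (Fin n) k) (q : ℕ) :
    colength h q + Module.finrank k (LinearMap.range (mulTrunc h q)) = q ^ n := by
  let π := (Ideal.Quotient.factorₐ k
    (le_sup_right : varPowIdeal k n q ≤ Ideal.span {h} ⊔ varPowIdeal k n q)).toLinearMap
  have hπ : Function.Surjective π := Ideal.Quotient.factor_surjective le_sup_right
  have hker : LinearMap.ker π = LinearMap.range (mulTrunc h q) := by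
    ext s
    obtain ⟨s, rfl⟩ := Ideal.Quotient.mk_surjective s
    have h1 : Ideal.Quotient.mk (varPowIdeal k n q) s ∈ LinearMap.ker π ↔
        s ∈ Ideal.span {h} ⊔ varPowIdeal k n q := Ideal.Quotient.eq_zero_iff_mem
    rw [h1, Ideal.mem_span_singleton_sup]
    constructor
    · rintro ⟨a, b, hb, rfl⟩
      refine ⟨Ideal.Quotient.mk _ a, ?_⟩
      rw [mulTrunc_mk, Ideal.Quotient.eq]
      rw [show h * a - (a * h + b) = -b by ring]
      exact neg_mem hb
    · rintro ⟨a, ha⟩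
      obtain ⟨a, rfl⟩ := Ideal.Quotient.mk_surjective a
      rw [mulTrunc_mk, Ideal.Quotient.eq] at ha
      exact ⟨a, s - a * h, by rw [mul_comm a, ← neg_sub]; exact neg_mem ha, by ring⟩
  have := π.finrank_range_add_finrank_ker
  rwa [LinearMap.range_eq_top.2 hπ, finrank_top, hker, finrank_quotient_varPowIdeal] at this

/-- Lexicographic leading exponents add and leading coefficients multiply. The leading exponent of
the product stays in the `q`-box, since `β i ≤ N` and the other factor lives in the box of side `q -
N`. -/
theorem mul_boxSeries_notMem {h : MvPowerSeries (Fin n) k} {β : Fin n →₀ ℕ}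
    (hβ : lexOrder h = toLex β) {N q : ℕ} (hN : ∀ i, β i ≤ N)
    {u : (Fin n → Fin (q - N)) → k} (hu : u ≠ 0) :
    h * boxSeries k n (q - N) u ∉ varPowIdeal k n q := by
  classical
  have hw : boxSeries k n (q - N) u ≠ 0 := fun h0 => hu <| by
    rw [← boxCoeff_boxSeries u, h0, map_zero]
  obtain ⟨d, hd⟩ := exists_finsupp_eq_lexOrder_of_ne_zero hw
  have hd0 := coeff_ne_zero_of_lexOrder hd.symm
  obtain ⟨v, rfl⟩ : ∃ v : Fin n → Fin (q - N), boxExp v = d := by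
    by_contra hc
    push Not at hc
    exact hd0 (by simp [coeff_boxSeries, fun v => (hc v).symm])
  intro hmem
  have h0 := mem_varPowIdeal_iff.1 hmem (β + boxExp v) fun i => by
    have := hN i
    have := (v i).2
    simp only [Finsupp.add_apply, boxExp_apply]
    omega
  rw [coeff_mul_of_add_lexOrder hβ hd] at h0
  exact mul_ne_zero (coeff_ne_zero_of_lexOrder hβ.symm) hd0 h0

theorem pow_le_sub_pow_add (q N n : ℕ) : q ^ n ≤ (q - N) ^ n + n * N * q ^ (n - 1) := by
  induction n with
  | zero => simp
  | succ n ih =>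
    -- The truncated exponent `n - 1` is harmless: for `n = 0` both sides vanish.
    have h1 : n * (N * q ^ n) = n * N * q ^ (n - 1) * q := by
      cases n with
      | zero => simp
      | succ m => rw [Nat.add_sub_cancel, pow_succ]; ring
    have h2 : (q - N) ^ n ≤ q ^ n := Nat.pow_le_pow_left (Nat.sub_le _ _) n
    calc q ^ (n + 1) = q ^ n * q := pow_succ _ _
      _ ≤ ((q - N) ^ n + n * N * q ^ (n - 1)) * q := Nat.mul_le_mul_right _ ih
      _ = (q - N) ^ n * q + n * (N * q ^ n) := by rw [h1, add_mul]
      _ ≤ (q - N) ^ n * ((q - N) + N) + n * (N * q ^ n) := by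
        gcongr
        omega
      _ = (q - N) ^ (n + 1) + (q - N) ^ n * N + n * (N * q ^ n) := by ring
      _ ≤ (q - N) ^ (n + 1) + q ^ n * N + n * (N * q ^ n) := by gcongr
      _ = (q - N) ^ (n + 1) + (n + 1) * N * q ^ (n + 1 - 1) := by
        rw [Nat.add_sub_cancel]; ring

/-- Multiplication by `h` is injective on polynomials supported in the box of side `q - N`, so its
rank is at least `(q - N)^n`, which misses `q^n` by at most `n * N * q^(n-1)`. -/
theorem exists_colength_le {h : MvPowerSeries (Fin n) k} (hh : h ≠ 0) :
    ∃ C : ℕ, ∀ q, colength h q ≤ C * q ^ (n - 1) := by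
  obtain ⟨β, hβ⟩ := exists_finsupp_eq_lexOrder_of_ne_zero hh
  refine ⟨n * ∑ i, β i, fun q => ?_⟩
  set N := ∑ i, β i
  have hN : ∀ i, β i ≤ N := fun i =>
    Finset.single_le_sum (f := fun i => β i) (fun _ _ => Nat.zero_le _) (Finset.mem_univ i)
  let φ : ((Fin n → Fin (q - N)) → k) →ₗ[k] LinearMap.range (mulTrunc h q) :=
    (mulTrunc h q).rangeRestrict ∘ₗ (Ideal.Quotient.mkₐ k (varPowIdeal k n q)).toLinearMap ∘ₗ
      boxSeries k n (q - N)
  have hφ : Function.Injective φ := by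
    rw [← LinearMap.ker_eq_bot, LinearMap.ker_eq_bot']
    intro u hu
    by_contra hu0
    apply mul_boxSeries_notMem hβ hN hu0
    rw [← Ideal.Quotient.eq_zero_iff_mem]
    exact congrArg Subtype.val hu
  have h1 := LinearMap.finrank_le_finrank_of_injective hφ
  have h2 := colength_add_finrank_range h q
  have h3 := pow_le_sub_pow_add q N n
  simp only [Module.finrank_fintype_fun_eq_card, Fintype.card_pi, Fintype.card_fin,
    Finset.prod_const, Finset.card_univ] at h1
  omega

end MvPowerSeries

/-! ### Cartier operators and existence of the limit. -/

namespace MvPowerSeries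

variable {k : Type*} [Field k] {n : ℕ}

section Frobenius

variable {p : ℕ} [Fact p.Prime] [CharP k p]

theorem coeff_smul_pow_char (a : MvPowerSeries (Fin n) k) (m : Fin n →₀ ℕ) :
    coeff (p • m) (a ^ p) = coeff m a ^ p := by
  have hp := (Fact.out : p.Prime).ne_zero
  rw [← map_frobenius_expand p hp, coeff_map, coeff_expand_smul, frobenius_def]

theorem coeff_pow_char_eq_zero (a : MvPowerSeries (Fin n) k) {m : Fin n →₀ ℕ}
    (hm : ¬ ∃ w : Fin n →₀ ℕ, p • w = m) : coeff m (a ^ p) = 0 := by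
  have hp := (Fact.out : p.Prime).ne_zero
  obtain ⟨i, hi⟩ : ∃ i, ¬ p ∣ m i := by
    by_contra hc
    push Not at hc
    exact hm ⟨Finsupp.equivFunOnFinite.symm fun i => m i / p, Finsupp.ext fun i =>
      Nat.mul_div_cancel' (hc i)⟩
  rw [← map_frobenius_expand p hp, coeff_map, coeff_expand_of_not_dvd p hp a hi, map_zero]

/-- Only exponents divisible by `p` occur in `a^p`, so the complementary exponent has the same
residue `v` modulo `p`. -/
theorem coeff_pow_char_mul (a s : MvPowerSeries (Fin n) k) (m : Fin n →₀ ℕ) (v : Fin n → Fin p) :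
    coeff (p • m + boxExp v) (a ^ p * s) =
      ∑ x ∈ Finset.HasAntidiagonal.antidiagonal m, coeff x.1 a ^ p * coeff (p • x.2 + boxExp v) s := by
  classical
  have hp := (Fact.out : p.Prime).pos
  rw [coeff_mul]
  symm
  refine Finset.sum_of_injOn (fun x => (p • x.1, p • x.2 + boxExp v)) ?_ ?_ ?_ ?_
  · rintro ⟨x, y⟩ _ ⟨x', y'⟩ _ h
    have h1 := (Prod.ext_iff.1 h).1
    have h2 := add_right_cancel (Prod.ext_iff.1 h).2
    have hinj : ∀ u w : Fin n →₀ ℕ, p • u = p • w → u = w := fun u w huw =>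
      Finsupp.ext fun i => Nat.eq_of_mul_eq_mul_left hp (DFunLike.congr_fun huw i)
    exact Prod.ext (hinj _ _ h1) (hinj _ _ h2)
  · intro x hx
    have hx := Finset.HasAntidiagonal.mem_antidiagonal.1 (Finset.mem_coe.1 hx)
    refine Finset.mem_coe.2 (Finset.HasAntidiagonal.mem_antidiagonal.2 ?_)
    rw [← hx, smul_add, add_assoc]
  · rintro ⟨x, y⟩ hxy hni
    have hxy : x + y = p • m + boxExp v := Finset.HasAntidiagonal.mem_antidiagonal.1 hxy
    rw [coeff_pow_char_eq_zero, zero_mul]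
    rintro ⟨w, rfl⟩
    apply hni
    -- Here `p * w i ≤ p * m i + v i < p * (m i + 1)`.
    have hle : w ≤ m := fun i => by
      have h1 := DFunLike.congr_fun hxy i
      simp only [Finsupp.add_apply, Finsupp.smul_apply, smul_eq_mul, boxExp_apply] at h1
      have h2 := (v i).2
      by_contra hc
      have h3 : p * (m i + 1) ≤ p * w i := Nat.mul_le_mul_left _ (not_le.1 hc)
      rw [mul_add, mul_one] at h3
      omega
    refine ⟨(w, m - w), Finset.mem_coe.2 (Finset.HasAntidiagonal.mem_antidiagonal.2
      (add_tsub_cancel_of_le hle)), Prod.ext rfl ?_⟩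
    have : p • w + (p • (m - w) + boxExp v) = p • w + y := by
      rw [← add_assoc, ← smul_add, add_tsub_cancel_of_le hle, hxy]
    exact add_left_cancel this
  · rintro ⟨x, y⟩ _
    rw [coeff_smul_pow_char]

variable [PerfectRing k p]

/-- The Cartier operator that picks out the exponents congruent to `v` modulo `p` and takes
`p`-th roots. -/
def cartier (v : Fin n → Fin p) : MvPowerSeries (Fin n) k →ₛₗ[((frobeniusEquiv k p).symm : k →+* k)]
    MvPowerSeries (Fin n) k where
  toFun s := fun m => (frobeniusEquiv k p).symm (coeff (p • m + boxExp v) s)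
  map_add' s t := by
    ext m
    change (frobeniusEquiv k p).symm (coeff (p • m + boxExp v) (s + t)) = _
    rw [map_add, map_add]
    rfl
  map_smul' c s := by
    ext m
    change (frobeniusEquiv k p).symm (coeff (p • m + boxExp v) (c • s)) = _
    rw [coeff_smul, map_mul]
    rfl

theorem coeff_cartier (v : Fin n → Fin p) (s : MvPowerSeries (Fin n) k) (m : Fin n →₀ ℕ) :
    coeff m (cartier v s) = (frobeniusEquiv k p).symm (coeff (p • m + boxExp v) s) := rfl

theorem cartier_pow_mul (v : Fin n → Fin p) (a s : MvPowerSeries (Fin n) k) :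
    cartier v (a ^ p * s) = a * cartier v s := by
  ext m
  rw [coeff_cartier, coeff_pow_char_mul, map_sum, coeff_mul]
  refine Finset.sum_congr rfl fun x _ => ?_
  rw [map_mul, coeff_cartier, ← frobenius_def, ← coe_frobeniusEquiv, RingEquiv.symm_apply_apply]

/-- With `cartier_pow_mul`, this makes the Cartier operators the coordinates dual to the monomials
of the `p`-box, up to `p`-th roots. -/
theorem cartier_monomial (v w : Fin n → Fin p) :
    cartier v (monomial (boxExp w) (1 : k)) = if v = w then 1 else 0 := by
  classical
  ext m
  rw [coeff_cartier, coeff_monomial]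
  have hiff : p • m + boxExp v = boxExp w ↔ m = 0 ∧ v = w := by
    constructor
    · intro h
      have hm : m = 0 := Finsupp.ext fun i => by
        have h1 := DFunLike.congr_fun h i
        simp only [Finsupp.add_apply, Finsupp.smul_apply, smul_eq_mul, boxExp_apply] at h1
        have h2 := (w i).2
        by_contra hc
        have h3 : p * 1 ≤ p * m i := Nat.mul_le_mul_left _ (Nat.pos_of_ne_zero hc)
        omega
      subst hm
      exact ⟨rfl, boxExp_injective (by simpa using h)⟩
    · rintro ⟨rfl, rfl⟩
      simp
  simp only [hiff]
  by_cases hv : v = w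
  · by_cases hm : m = 0 <;> simp [hv, hm, coeff_one]
  · simp [hv]

theorem cartier_mem {h : MvPowerSeries (Fin n) k} {q : ℕ} {s : MvPowerSeries (Fin n) k}
    (hs : s ∈ Ideal.span {h ^ p} ⊔ varPowIdeal k n (p * q)) (v : Fin n → Fin p) :
    cartier v s ∈ Ideal.span {h} ⊔ varPowIdeal k n q := by
  -- `cartier v` is linear only over `p`-th powers, so the induction over the span needs an
  -- arbitrary multiplier. All generators are `p`-th powers and can be pulled out.
  suffices ∀ a, cartier v (a * s) ∈ Ideal.span {h} ⊔ varPowIdeal k n q by simpa using this 1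
  rw [varPowIdeal, ← Ideal.span_union] at hs
  induction hs using Submodule.span_induction with
  | mem x hx =>
    intro a
    rw [mul_comm]
    rcases hx with hx | ⟨i, rfl⟩
    · rw [Set.mem_singleton_iff.1 hx, cartier_pow_mul]
      exact Ideal.mul_mem_right _ _ (Ideal.mem_sup_left (Ideal.mem_span_singleton_self h))
    · dsimp only
      rw [mul_comm p, pow_mul, cartier_pow_mul]
      exact Ideal.mul_mem_right _ _ (Ideal.mem_sup_right (X_pow_mem_varPowIdeal q i))
  | zero => simp
  | add x y _ _ hx hy => exact fun a => by rw [mul_add, map_add]; exact add_mem (hx a) (hy a)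
  | smul b x _ hx => exact fun a => by rw [smul_eq_mul, ← mul_assoc]; exact hx (a * b)

/-- The Cartier operators with values in `k[[x]]/(h, x_1^q,…,x_n^q)`. -/
def cartierMk (h : MvPowerSeries (Fin n) k) (q : ℕ) :
    MvPowerSeries (Fin n) k →ₛₗ[((frobeniusEquiv k p).symm : k →+* k)]
      ((Fin n → Fin p) → MvPowerSeries (Fin n) k ⧸ (Ideal.span {h} ⊔ varPowIdeal k n q)) where
  toFun s v := Ideal.Quotient.mk _ (cartier v s)
  map_add' s t := funext fun v => by rw [map_add, map_add, Pi.add_apply]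
  map_smul' c s := funext fun v => by rw [map_smulₛₗ]; rfl

theorem cartierMk_apply (h s : MvPowerSeries (Fin n) k) (q : ℕ) (v : Fin n → Fin p) :
    cartierMk h q s v = Ideal.Quotient.mk _ (cartier v s) := rfl

theorem cartierMk_surjective (h : MvPowerSeries (Fin n) k) (q : ℕ) :
    Function.Surjective (cartierMk (p := p) h q) := by
  intro b
  choose s hs using fun v => Ideal.Quotient.mk_surjective (b v)
  refine ⟨∑ w, s w ^ p * monomial (boxExp w) 1, funext fun v => ?_⟩
  rw [cartierMk_apply, ← hs, map_sum]
  congr 1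
  simp [cartier_pow_mul, cartier_monomial]

theorem le_ker_cartierMk (h : MvPowerSeries (Fin n) k) (q : ℕ) :
    (Ideal.span {h ^ p} ⊔ varPowIdeal k n (p * q)).restrictScalars k ≤
      LinearMap.ker (cartierMk (p := p) h q) := fun _ hs =>
  LinearMap.mem_ker.2 (funext fun v => Ideal.Quotient.eq_zero_iff_mem.2 (cartier_mem hs v))

/-- Lifts of a basis stay independent because a homomorphism of fields is injective; `σ` need not be
onto. -/
theorem _root_.LinearMap.finrank_le_of_surjective_semilinear {K K' V V' : Type*} [Field K]
    [Field K'] [AddCommGroup V] [AddCommGroup V'] [Module K V] [Module K' V'] [Module.Finite K V]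
    [Module.Finite K' V'] {σ : K →+* K'} (T : V →ₛₗ[σ] V') (hT : Function.Surjective T) :
    Module.finrank K' V' ≤ Module.finrank K V := by
  let b := Module.finBasis K' V'
  choose w hw using fun i => hT (b i)
  have hli : LinearIndependent K w := by
    rw [Fintype.linearIndependent_iff]
    intro c hc i
    have h1 : ∑ i, σ (c i) • b i = 0 := by
      rw [← map_zero T, ← hc, map_sum]
      exact Finset.sum_congr rfl fun i _ => by rw [map_smulₛₗ, hw]
    exact (_root_.map_eq_zero σ).1 (Fintype.linearIndependent_iff.1 b.linearIndependent _ h1 i)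
  simpa using hli.fintype_card_le_finrank

/-- The `p^n` Cartier operators together map `k[[x]]/(h^p, x_i^{pq})` onto `p^n` copies of
`k[[x]]/(h, x_i^q)`. -/
theorem pow_mul_colength_le (h : MvPowerSeries (Fin n) k) (q : ℕ) :
    p ^ n * colength h q ≤ colength (h ^ p) (p * q) := by
  set I := Ideal.span {h ^ p} ⊔ varPowIdeal k n (p * q) with hI
  let e := Submodule.Quotient.restrictScalarsEquiv k I
  have : Module.Finite k (MvPowerSeries (Fin n) k ⧸ I) :=
    finite_quotient_of_varPowIdeal_le le_sup_right
  have : Module.Finite k (MvPowerSeries (Fin n) k ⧸ I.restrictScalars k) :=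
    Module.Finite.equiv e.symm
  have h1 := LinearMap.finrank_le_of_surjective_semilinear
    ((I.restrictScalars k).liftQ (cartierMk (p := p) h q) (le_ker_cartierMk h q))
    (fun b => (cartierMk_surjective h q b).imp' (Submodule.mkQ _) fun _ hs => hs)
  rw [Module.finrank_pi_fintype, e.finrank_eq] at h1
  simpa [colength] using h1

end Frobenius

/-- Modulo `J`, the sequence `S/(b) → S/(ab) → S/(a) → 0` with first map multiplication by `a` is
exact, where `S = k[[x]]`. -/
theorem colength_mul_le (a b : MvPowerSeries (Fin n) k) (q : ℕ) :
    colength (a * b) q ≤ colength a q + colength b q := by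
  set J := varPowIdeal k n q
  have hle : Ideal.span {a * b} ⊔ J ≤ Ideal.span {a} ⊔ J :=
    sup_le_sup_right (Ideal.span_singleton_le_span_singleton.2 (dvd_mul_right a b)) J
  let π := (Ideal.Quotient.factorₐ k hle).toLinearMap
  have hπ : Function.Surjective π := Ideal.Quotient.factor_surjective hle
  have hmul : Ideal.span {b} ⊔ J ≤
      Submodule.comap (LinearMap.mulLeft (MvPowerSeries (Fin n) k) a) (Ideal.span {a * b} ⊔ J) := by
    refine sup_le ((Ideal.span_singleton_le_iff_mem _).2 ?_) fun s hs => ?_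
    · exact Ideal.mem_sup_left (Ideal.mem_span_singleton_self _)
    · exact Ideal.mem_sup_right (Ideal.mul_mem_left J a hs)
  let μ : (MvPowerSeries (Fin n) k ⧸ (Ideal.span {b} ⊔ J)) →ₗ[k]
      (MvPowerSeries (Fin n) k ⧸ (Ideal.span {a * b} ⊔ J)) :=
    (Submodule.mapQ _ _ _ hmul).restrictScalars k
  have hker : LinearMap.ker π ≤ LinearMap.range μ := by
    intro s hs
    obtain ⟨s, rfl⟩ := Ideal.Quotient.mk_surjective s
    have hs' : s ∈ Ideal.span {a} ⊔ J := Ideal.Quotient.eq_zero_iff_mem.1 hs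
    obtain ⟨c, d, hd, rfl⟩ := Ideal.mem_span_singleton_sup.1 hs'
    refine ⟨Ideal.Quotient.mk _ c, ?_⟩
    change Ideal.Quotient.mk _ (a * c) = _
    rw [Ideal.Quotient.eq, show a * c - (c * a + d) = -d by ring]
    exact neg_mem (Ideal.mem_sup_right hd)
  have h1 := π.finrank_range_add_finrank_ker
  rw [LinearMap.range_eq_top.2 hπ, finrank_top] at h1
  have h2 := Submodule.finrank_mono hker
  have h3 := μ.finrank_range_le
  change Module.finrank k (MvPowerSeries (Fin n) k ⧸ (Ideal.span {a * b} ⊔ J)) ≤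
    Module.finrank k (MvPowerSeries (Fin n) k ⧸ (Ideal.span {a} ⊔ J)) +
      Module.finrank k (MvPowerSeries (Fin n) k ⧸ (Ideal.span {b} ⊔ J))
  omega

theorem colength_pow_le (h : MvPowerSeries (Fin n) k) (q m : ℕ) :
    colength (h ^ m) q ≤ m * colength h q := by
  induction m with
  | zero =>
    rw [pow_zero, zero_mul, Nat.le_zero, colength,
      show Ideal.span {(1 : MvPowerSeries (Fin n) k)} ⊔ varPowIdeal k n q = ⊤ by
        rw [Ideal.span_singleton_one, top_sup_eq]]
    exact Module.finrank_zero_of_subsingleton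
  | succ m ih =>
    rw [pow_succ, add_mul, one_mul]
    exact (colength_mul_le _ _ _).trans (Nat.add_le_add_right ih _)

/-- The sequence `colength h (p ^ e) / (p ^ e) ^ (n - 1)` is monotone. -/
theorem monotone_colength_div (p : ℕ) [Fact p.Prime] [CharP k p] [PerfectRing k p] (hn : n ≠ 0)
    (h : MvPowerSeries (Fin n) k) :
    Monotone fun e : ℕ => (colength h (p ^ e) : ℝ) / ((p : ℝ) ^ e) ^ (n - 1) := by
  have hp : 0 < p := (Fact.out : p.Prime).pos
  refine monotone_nat_of_le_succ fun e => ?_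
  have h1 : p ^ (n - 1) * colength h (p ^ e) ≤ colength h (p ^ (e + 1)) := by
    have h2 := (pow_mul_colength_le (p := p) h (p ^ e)).trans (colength_pow_le h _ p)
    obtain ⟨m, rfl⟩ := Nat.exists_eq_succ_of_ne_zero hn
    -- Cancelling one factor `p` lowers the exponent from `n` to `n - 1`; this is where `n ≠ 0`
    -- enters.
    refine Nat.le_of_mul_le_mul_left (le_trans (le_of_eq ?_) (h2.trans (le_of_eq ?_))) hp
    · rw [← mul_assoc, ← pow_succ']
      rfl
    · rw [← pow_succ']
  have h3 : (p : ℝ) ^ (n - 1) * colength h (p ^ e) ≤ colength h (p ^ (e + 1)) := by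
    exact_mod_cast h1
  have hp' : (0 : ℝ) < p := by exact_mod_cast hp
  rw [div_le_div_iff₀ (by positivity) (by positivity), pow_succ, mul_pow]
  calc (colength h (p ^ e) : ℝ) * (((p : ℝ) ^ e) ^ (n - 1) * (p : ℝ) ^ (n - 1))
      = ((p : ℝ) ^ (n - 1) * colength h (p ^ e)) * ((p : ℝ) ^ e) ^ (n - 1) := by ring
    _ ≤ _ := by gcongr

theorem exists_tendsto_colength_div (p : ℕ) [Fact p.Prime] [CharP k p] [PerfectRing k p]
    (hn : n ≠ 0) {h : MvPowerSeries (Fin n) k} (hh : h ≠ 0) :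
    ∃ l : ℝ, Tendsto (fun e : ℕ => (colength h (p ^ e) : ℝ) / ((p : ℝ) ^ e) ^ (n - 1)) atTop
      (𝓝 l) := by
  have hp : (0 : ℝ) < p := by exact_mod_cast (Fact.out : p.Prime).pos
  obtain ⟨C, hC⟩ := exists_colength_le hh
  refine ⟨_, tendsto_atTop_ciSup (monotone_colength_div p hn h) ⟨C, ?_⟩⟩
  rintro _ ⟨e, rfl⟩
  dsimp only
  rw [div_le_iff₀ (by positivity)]
  exact_mod_cast hC (p ^ e)

end MvPowerSeries

/-! ### Semicontinuity of rank and Zariski density. -/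

/-- A maximal minor that equals `1` at `α₀` is a nonzero polynomial in `α`, and the rank can drop
only at its roots. -/
theorem LinearMap.finite_setOf_finrank_range_lt {K V W : Type*} [Field K] [AddCommGroup V]
    [AddCommGroup W] [Module K V] [Module K W] [Module.Finite K W] (A B : V →ₗ[K] W) (α₀ : K) :
    {α : K | Module.finrank K (LinearMap.range (A + α • B)) <
      Module.finrank K (LinearMap.range (A + α₀ • B))}.Finite := by
  classical
  set R := LinearMap.range (A + α₀ • B)
  let b := Module.finBasis K R
  choose v hv using fun i => (b i).2
  obtain ⟨π, hπ⟩ := R.subtype.exists_leftInverse_of_injective R.ker_subtype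
  -- `j` projects `W` onto the range at `α₀` and takes coordinates there. With the lifts `v` of the
  -- basis it cuts out a square matrix that is the identity at `α₀`.
  let j := b.equivFun.toLinearMap ∘ₗ π
  let N : (V →ₗ[K] W) → Matrix (Fin (Module.finrank K R)) (Fin (Module.finrank K R)) K :=
    fun L => Matrix.of fun r s => j (L (v s)) r
  let D : Polynomial K := ((N A).map Polynomial.C + (Polynomial.X : Polynomial K) •
    (N B).map Polynomial.C).det
  have hD : ∀ α, D.eval α = (N (A + α • B)).det := by
    intro α
    rw [← Polynomial.coe_evalRingHom, RingHom.map_det]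
    congr 1
    ext r s
    simpa [N] using mul_comm _ _
  have hN0 : N (A + α₀ • B) = 1 := by
    ext r s
    have h1 : π (b s : W) = b s := LinearMap.congr_fun hπ (b s)
    have : j ((A + α₀ • B) (v s)) = Pi.single s 1 := by
      rw [hv]
      simp only [j, LinearMap.comp_apply, h1, LinearEquiv.coe_coe]
      ext i
      simp [Pi.single_apply, eq_comm]
    simp only [N, Matrix.of_apply, this, Matrix.one_apply, Pi.single_apply]
  have hD0 : D ≠ 0 := by
    intro h0
    have := hD α₀
    rw [hN0, h0] at this
    simp at this
  refine (D.roots.toFinset.finite_toSet).subset fun α hα => ?_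
  rw [Finset.mem_coe, Multiset.mem_toFinset, Polynomial.mem_roots hD0, Polynomial.IsRoot.def, hD]
  by_contra hdet
  refine absurd (Set.mem_ofPred_eq ▸ hα) (not_lt.2 ?_)
  have hcols := Matrix.linearIndependent_cols_of_det_ne_zero hdet
  have hli : LinearIndependent K fun s => (A + α • B).rangeRestrict (v s) := by
    exact LinearIndependent.of_comp (j ∘ₗ (LinearMap.range (A + α • B)).subtype) hcols
  simpa using hli.fintype_card_le_finrank

theorem MvPowerSeries.finite_setOf_colength_lt {k : Type*} [Field k] {n : ℕ}
    (f g : MvPowerSeries (Fin n) k) (α₀ : k) (q : ℕ) :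
    {α : k | colength (f + α₀ • g) q < colength (f + α • g) q}.Finite := by
  refine (LinearMap.finite_setOf_finrank_range_lt (mulTrunc f q) (mulTrunc g q) α₀).subset
    fun α hα => ?_
  have h1 := colength_add_finrank_range (f + α • g) q
  have h2 := colength_add_finrank_range (f + α₀ • g) q
  rw [mulTrunc_add_smul] at h1 h2
  rw [Set.mem_ofPred_eq] at hα ⊢
  omega

/-- A nonempty open set contains all non-roots of some nonzero polynomial `r`, and finitely many
roots plus a countable set cannot exhaust `k`. -/
theorem dense_zariskiLine_of_countable_compl {k : Type*} [Field k] [Uncountable k] {Λ : Set k}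
    (hΛ : Λᶜ.Countable) : @Dense k (zariskiLine k) Λ := by
  classical
  let _ := zariskiLine k
  rw [dense_iff_inter_open]
  rintro _ ⟨U, hU, rfl⟩ ⟨α, hα⟩
  obtain ⟨_, ⟨r, rfl⟩, hr, hrU⟩ :=
    PrimeSpectrum.isTopologicalBasis_basic_opens.exists_subset_of_mem_open hα hU
  have hr0 : r ≠ 0 := by
    rintro rfl
    exact hr (zero_mem _)
  have hroots : ((r.roots.toFinset : Set k) ∪ Λᶜ).Countable :=
    (Finset.countable_toSet _).union hΛ
  obtain ⟨β, hβ⟩ : ∃ β, β ∉ (r.roots.toFinset : Set k) ∪ Λᶜ := by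
    by_contra hc
    push Not at hc
    exact Set.not_countable_univ (hroots.mono fun x _ => hc x)
  rw [Set.mem_union, not_or, Set.notMem_compl_iff] at hβ
  refine ⟨β, hrU ?_, hβ.2⟩
  intro hmem
  apply hβ.1
  rw [Finset.mem_coe, Multiset.mem_toFinset, Polynomial.mem_roots hr0]
  exact Polynomial.dvd_iff_isRoot.1 (Ideal.mem_span_singleton.1 hmem)

/-! ### Length as vector space dimension, and Krull dimension. -/

/-- The only simple module is the residue field, which is one-dimensional over `k`; induction splits
off one simple quotient at a time. -/
theorem Module.length_eq_finrank_of_surjective_residueField {k A : Type*} [Field k] [CommRing A]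
    [IsLocalRing A] [Algebra k A]
    (hres : Function.Surjective (algebraMap k (A ⧸ IsLocalRing.maximalIdeal A))) (M : Type*)
    [AddCommGroup M] [Module A M] [Module k M] [IsScalarTower k A M] [Module.Finite k M] :
    Module.length A M = Module.finrank k M := by
  induction hd : Module.finrank k M using Nat.strong_induction_on generalizing M with
  | _ d ih =>
  subst hd
  rcases subsingleton_or_nontrivial M with hM | hM
  · rw [Module.length_eq_zero, Module.finrank_zero_of_subsingleton, Nat.cast_zero]
  have : Module.Finite A M := Module.Finite.of_restrictScalars_finite k A M
  obtain ⟨N, hN, -⟩ := (eq_top_or_exists_le_coatom (⊥ : Submodule A M)).resolve_left bot_ne_top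
  have hsimple : IsSimpleModule A (M ⧸ N) := isSimpleModule_iff_isCoatom.2 hN
  have hlen := Module.length_eq_add_of_exact N.subtype N.mkQ N.injective_subtype N.mkQ_surjective
    (LinearMap.exact_subtype_mkQ N)
  rw [Module.length_eq_one A (M ⧸ N)] at hlen
  have h1 : Module.finrank k (M ⧸ N) = 1 := by
    obtain ⟨I, hI, ⟨e⟩⟩ := isSimpleModule_iff_quot_maximal.1 hsimple
    obtain rfl := IsLocalRing.eq_maximalIdeal hI
    rw [(e.restrictScalars k).finrank_eq]
    refine finrank_eq_one 1 one_ne_zero fun w => ?_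
    obtain ⟨c, rfl⟩ := hres w
    exact ⟨c, (Algebra.algebraMap_eq_smul_one c).symm⟩
  have h2 := Submodule.finrank_quotient_add_finrank (N.restrictScalars k)
  have h3 : Module.finrank k (M ⧸ N.restrictScalars k) = 1 := by
    rw [← h1]
    exact (Submodule.Quotient.restrictScalarsEquiv k N).finrank_eq
  have h4 : Module.finrank k (N.restrictScalars k) = Module.finrank k N := rfl
  have : Module.Finite k N := inferInstanceAs (Module.Finite k (N.restrictScalars k))
  rw [hlen, ih _ (by omega) N rfl, ← h2, h3, h4, add_comm, Nat.cast_add, Nat.cast_one]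

theorem PowerSeries.ker_constantCoeff (R : Type*) [CommRing R] :
    RingHom.ker (PowerSeries.constantCoeff (R := R)) = Ideal.span {PowerSeries.X} := by
  refine Ideal.ext fun s => ?_
  rw [RingHom.mem_ker, Ideal.mem_span_singleton, PowerSeries.X_dvd_iff]

theorem PowerSeries.ringKrullDim_quotient_span_X (R : Type*) [CommRing R] :
    ringKrullDim (PowerSeries R ⧸ Ideal.span {(PowerSeries.X : PowerSeries R)}) = ringKrullDim R :=
  ringKrullDim_eq_of_ringEquiv ((Ideal.quotEquivOfEq (PowerSeries.ker_constantCoeff R).symm).trans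
    (RingHom.quotientKerEquivOfSurjective PowerSeries.constantCoeff_surj))

theorem PowerSeries.ringKrullDim_eq_succ (R : Type*) [CommRing R] [IsNoetherianRing R]
    [IsLocalRing R] : ringKrullDim (PowerSeries R) = ringKrullDim R + 1 := by
  have hloc : IsLocalRing (PowerSeries R) := inferInstance
  have hX : (PowerSeries.X : PowerSeries R) ∈ IsLocalRing.maximalIdeal (PowerSeries R) := by
    rw [IsLocalRing.mem_maximalIdeal, mem_nonunits_iff, PowerSeries.isUnit_iff_constantCoeff]
    simp
  have hX0 : (PowerSeries.X : PowerSeries R) ∈ nonZeroDivisors (PowerSeries R) :=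
    MvPowerSeries.X_mem_nonzeroDivisors
  have := ringKrullDim_quotient_span_singleton_succ_eq_ringKrullDim_of_mem_nonZeroDivisors hX0 hX
  rw [← this, PowerSeries.ringKrullDim_quotient_span_X]

theorem WithBot.eq_natCast_of_add_one_eq {x : WithBot ℕ∞} {m : ℕ}
    (h : x + 1 = (m : WithBot ℕ∞) + 1) : x = m := by
  cases x with
  | bot => exact absurd h (by rw [WithBot.bot_add]; exact WithBot.bot_ne_coe)
  | coe y =>
    have h2 : y + 1 = (m : ℕ∞) + 1 := WithBot.coe_injective h
    exact congrArg _ (ENat.add_left_injective_of_ne_top ENat.one_ne_top h2)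

namespace MvPowerSeries

variable {k : Type*} [Field k] {n : ℕ}

theorem ringKrullDim_eq (k : Type*) [Field k] (n : ℕ) :
    ringKrullDim (MvPowerSeries (Fin n) k) = n := by
  induction n with
  | zero =>
    rw [ringKrullDim_eq_of_ringEquiv (isEmptyEquiv (Fin 0) k).toRingEquiv, ringKrullDim_eq_zero_of_field]
    rfl
  | succ n ih =>
    rw [ringKrullDim_eq_of_ringEquiv (finSuccEquiv k n).toRingEquiv,
      PowerSeries.ringKrullDim_eq_succ, ih, Nat.cast_add, Nat.cast_one]

theorem maximalIdeal_eq_varPowIdeal_one :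
    IsLocalRing.maximalIdeal (MvPowerSeries (Fin n) k) = varPowIdeal k n 1 := by
  ext s
  rw [IsLocalRing.mem_maximalIdeal, mem_nonunits_iff, isUnit_iff_constantCoeff,
    mem_varPowIdeal_iff, isUnit_iff_ne_zero, not_not]
  constructor
  · intro h m hm
    obtain rfl : m = 0 := Finsupp.ext fun i => Nat.lt_one_iff.1 (hm i)
    exact h
  · exact fun h => h 0 fun _ => zero_lt_one

theorem ne_zero_of_constantCoeff_eq_zero {h : MvPowerSeries (Fin n) k} (hh : h ≠ 0)
    (h0 : constantCoeff h = 0) : n ≠ 0 := by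
  rintro rfl
  refine hh (MvPowerSeries.ext fun m => ?_)
  rw [Subsingleton.elim m 0, map_zero]
  exact h0

theorem mem_maximalIdeal_of_constantCoeff_eq_zero {h : MvPowerSeries (Fin n) k}
    (h0 : constantCoeff h = 0) : h ∈ IsLocalRing.maximalIdeal (MvPowerSeries (Fin n) k) := by
  rw [IsLocalRing.mem_maximalIdeal, mem_nonunits_iff, isUnit_iff_constantCoeff, h0]
  exact not_isUnit_zero

end MvPowerSeries

/-! ### Hilbert–Kunz sequence of a hypersurface ring. -/

open MvPowerSeries

section HypersurfaceRing

variable {k : Type*} [Field k] {n : ℕ} {h : MvPowerSeries (Fin n) k}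

theorem HypersurfaceRing.krullDimNat_eq (hh : h ≠ 0) (h0 : constantCoeff h = 0) :
    krullDimNat (HypersurfaceRing h) = n - 1 := by
  have h1 := ringKrullDim_quotient_span_singleton_succ_eq_ringKrullDim_of_mem_nonZeroDivisors
    (mem_nonZeroDivisors_of_ne_zero hh) (mem_maximalIdeal_of_constantCoeff_eq_zero h0)
  rw [ringKrullDim_eq] at h1
  obtain ⟨m, rfl⟩ := Nat.exists_eq_succ_of_ne_zero (ne_zero_of_constantCoeff_eq_zero hh h0)
  rw [Nat.cast_succ] at h1
  have h2 : ringKrullDim (HypersurfaceRing h) = (m : WithBot ℕ∞) :=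
    WithBot.eq_natCast_of_add_one_eq h1
  rw [krullDimNat, h2]
  rfl

/-- The quotient of `k[[x]]/(h)` by `(x_1^q,…,x_n^q)` as a quotient of `k[[x]]`. -/
def HypersurfaceRing.quotientMapVarPowIdealEquiv (h : MvPowerSeries (Fin n) k) (q : ℕ) :
    (HypersurfaceRing h ⧸ (varPowIdeal k n q).map (Ideal.Quotient.mk (Ideal.span {h}))) ≃ₗ[k]
      (MvPowerSeries (Fin n) k ⧸ (Ideal.span {h} ⊔ varPowIdeal k n q)) :=
  (AlgEquiv.ofRingEquiv (f := DoubleQuot.quotQuotEquivQuotSup (Ideal.span {h})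
    (varPowIdeal k n q)) fun _ => rfl).toLinearEquiv

variable [IsLocalRing (HypersurfaceRing h)]

theorem HypersurfaceRing.maximalIdeal_eq :
    IsLocalRing.maximalIdeal (HypersurfaceRing h) =
      (varPowIdeal k n 1).map (Ideal.Quotient.mk (Ideal.span {h})) := by
  rw [← maximalIdeal_eq_varPowIdeal_one]
  exact (IsLocalRing.map_maximalIdeal_of_surjective _ Ideal.Quotient.mk_surjective).symm

/-- In characteristic `p` the bracket power is the extension along iterated Frobenius, so the `q`-th
powers of generators suffice. -/
theorem HypersurfaceRing.bracketPower_maximalIdeal (p : ℕ) [Fact p.Prime] [CharP k p] (e : ℕ) :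
    bracketPower (IsLocalRing.maximalIdeal (HypersurfaceRing h)) (p ^ e) =
      (varPowIdeal k n (p ^ e)).map (Ideal.Quotient.mk (Ideal.span {h})) := by
  have : CharP (HypersurfaceRing h) p :=
    charP_of_injective_algebraMap (algebraMap k (HypersurfaceRing h)).injective p
  have h1 : bracketPower (IsLocalRing.maximalIdeal (HypersurfaceRing h)) (p ^ e) =
      (IsLocalRing.maximalIdeal (HypersurfaceRing h)).map
        (iterateFrobenius (HypersurfaceRing h) p e) := by
    rw [bracketPower, Ideal.map]
    rfl
  rw [h1, maximalIdeal_eq, varPowIdeal, varPowIdeal, Ideal.map_span, Ideal.map_span, Ideal.map_span,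
    ← Set.range_comp, ← Set.range_comp, ← Set.range_comp]
  congr 2
  ext i
  simp [iterateFrobenius_def]

theorem HypersurfaceRing.algebraMap_residue_surjective :
    Function.Surjective (algebraMap k
      (HypersurfaceRing h ⧸ IsLocalRing.maximalIdeal (HypersurfaceRing h))) := by
  intro a
  obtain ⟨a, rfl⟩ := Ideal.Quotient.mk_surjective a
  obtain ⟨s, rfl⟩ := Ideal.Quotient.mk_surjective a
  refine ⟨constantCoeff s, ?_⟩
  change Ideal.Quotient.mk _ (Ideal.Quotient.mk _ (C (constantCoeff s))) = _
  rw [Ideal.Quotient.eq, ← map_sub, maximalIdeal_eq, ← maximalIdeal_eq_varPowIdeal_one]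
  exact Ideal.mem_map_of_mem _ (mem_maximalIdeal_of_constantCoeff_eq_zero (by simp))

theorem HypersurfaceRing.hkSeq_eq (p : ℕ) [Fact p.Prime] [CharP k p] (hh : h ≠ 0)
    (h0 : constantCoeff h = 0) :
    hkSeq p (HypersurfaceRing h) =
      fun e => (colength h (p ^ e) : ℝ) / ((p : ℝ) ^ e) ^ (n - 1) := by
  ext e
  let E := HypersurfaceRing.quotientMapVarPowIdealEquiv h (p ^ e)
  have hfin := Module.Finite.equiv E.symm
  have hlen := Module.length_eq_finrank_of_surjective_residueField (k := k)
    (HypersurfaceRing.algebraMap_residue_surjective (h := h)) (HypersurfaceRing h ⧸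
      (varPowIdeal k n (p ^ e)).map (Ideal.Quotient.mk (Ideal.span {h})))
  rw [E.finrank_eq] at hlen
  rw [hkSeq, HypersurfaceRing.krullDimNat_eq hh h0, bracketPower_maximalIdeal p e, hlen,
    ENat.toNat_natCast, colength]

end HypersurfaceRing

theorem hkSeq_congr {A B : Type*} [CommRing A] [IsLocalRing A] [CommRing B] [IsLocalRing B]
    (φ : A ≃+* B) (p : ℕ) : hkSeq p A = hkSeq p B := by
  have hb : ∀ q, (bracketPower (IsLocalRing.maximalIdeal B) q) =
      (bracketPower (IsLocalRing.maximalIdeal A) q).map (φ : A →+* B) := by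
    intro q
    have hm : (IsLocalRing.maximalIdeal B : Set B) = φ '' (IsLocalRing.maximalIdeal A : Set A) := by
      ext b
      obtain ⟨a, rfl⟩ := φ.surjective b
      simp [φ.injective.mem_set_image]
    rw [bracketPower, bracketPower, Ideal.map_span, hm, Set.image_image, Set.image_image]
    simp
  ext e
  have hd : krullDimNat A = krullDimNat B := by
    rw [krullDimNat, krullDimNat, ringKrullDim_eq_of_ringEquiv φ]
  rw [hkSeq, hkSeq, hd]
  congr 3
  let _ : Algebra A B := (φ : A →+* B).toAlgebra
  -- Both lengths are compared over `A`, with `B` made an `A`-algebra through `φ`.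
  rw [← Module.length_eq_of_surjective (S := A) (R := B) φ.surjective]
  let ψ := Ideal.quotientEquiv _ _ φ (hb (p ^ e))
  refine LinearEquiv.length_eq { ψ with map_smul' := fun a x => ?_ }
  obtain ⟨x, rfl⟩ := Ideal.Quotient.mk_surjective x
  change Ideal.Quotient.mk _ (φ (a * x)) = Ideal.Quotient.mk _ (φ a * φ x)
  rw [map_mul]

/-! ### Fibers of the pencil. -/

namespace HypersurfacePencil

variable {k : Type*} [Field k] {n : ℕ} (P : HypersurfacePencil k n)

theorem member_ne_zero (α : k) : P.member α ≠ 0 := by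
  intro h
  by_cases hα : α = 0
  · subst hα
    exact P.f_ne_zero (by simpa [member] using h)
  · refine P.g_not_mem (-α⁻¹) ?_
    rw [neg_smul, eq_neg_of_add_eq_zero_left h, smul_neg, neg_neg, smul_smul, inv_mul_cancel₀ hα,
      one_smul]

theorem exists_fiberEquiv (α : k) : Nonempty (P.Fiber α ≃+* HypersurfaceRing (P.member α)) := by
  let ev : Polynomial (MvPowerSeries (Fin n) k) →+* MvPowerSeries (Fin n) k :=
    Polynomial.evalRingHom (C α)
  have hev : ev P.equation = P.member α := by
    simpa [ev, equation, member, smul_eq_C_mul] using mul_comm _ _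
  let θ : Polynomial (MvPowerSeries (Fin n) k) →+* HypersurfaceRing (P.member α) :=
    (Ideal.Quotient.mk _).comp ev
  have hθeq : ∀ a ∈ Ideal.span {P.equation}, θ a = 0 := by
    intro a ha
    obtain ⟨b, rfl⟩ := Ideal.mem_span_singleton'.1 ha
    rw [map_mul, show θ P.equation = 0 from Ideal.Quotient.eq_zero_iff_mem.2
      (hev ▸ Ideal.mem_span_singleton_self _), mul_zero]
  let θ' : P.TotalRing →+* HypersurfaceRing (P.member α) := Ideal.Quotient.lift _ θ hθeq
  have hθ' : ∀ b, θ' (P.toTotal b) = Ideal.Quotient.mk _ (b.eval (C α)) := fun b => rfl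
  have hsurj : Function.Surjective θ' := by
    intro a
    obtain ⟨s, rfl⟩ := Ideal.Quotient.mk_surjective a
    exact ⟨P.toTotal (Polynomial.C s), by rw [hθ', Polynomial.eval_C]⟩
  have hker : RingHom.ker θ' = Ideal.span {P.tSub α} := by
    apply le_antisymm
    · intro a ha
      obtain ⟨b, rfl⟩ := P.toTotal_surjective a
      rw [RingHom.mem_ker, hθ', Ideal.Quotient.eq_zero_iff_mem, Ideal.mem_span_singleton'] at ha
      obtain ⟨c, hc⟩ := ha
      -- Subtracting a multiple of the equation, which is zero in `R`, makes the value at `t = α`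
      -- vanish, not merely lie in `(f + αg)`.
      have hdvd : Polynomial.X - Polynomial.C (C α) ∣ b - Polynomial.C c * P.equation := by
        rw [Polynomial.dvd_iff_isRoot, Polynomial.IsRoot.def, Polynomial.eval_sub,
          Polynomial.eval_mul, Polynomial.eval_C, ← hc, show Polynomial.eval (C α) P.equation = _ from hev,
          sub_self]
      obtain ⟨d, hd⟩ := hdvd
      have h0 : P.toTotal P.equation = 0 :=
        Ideal.Quotient.eq_zero_iff_mem.2 (Ideal.mem_span_singleton_self _)
      have h1 := congrArg P.toTotal hd
      rw [map_sub, map_mul, h0, mul_zero, sub_zero, map_mul] at h1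
      rw [h1]
      exact Ideal.mul_mem_right _ _ (Ideal.mem_span_singleton_self _)
    · rw [Ideal.span_singleton_le_iff_mem, RingHom.mem_ker, tSub, hθ']
      simp
  exact ⟨(Ideal.quotEquivOfEq hker.symm).trans (RingHom.quotientKerEquivOfSurjective hsurj)⟩

/-- The fiber is local with maximal ideal `fiberMaxIdeal α`, so localizing there inverts only units.
-/
theorem exists_localFiberEquiv (α : k) :
    Nonempty (P.LocalFiber α ≃+* HypersurfaceRing (P.member α)) := by
  obtain ⟨E⟩ := P.exists_fiberEquiv α
  have hloc : IsLocalRing (P.Fiber α) := E.symm.isLocalRing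
  have hmax : P.fiberMaxIdeal α = IsLocalRing.maximalIdeal (P.Fiber α) :=
    IsLocalRing.eq_maximalIdeal inferInstance
  have hunits : ∀ x ∈ (P.fiberMaxIdeal α).primeCompl, IsUnit x := fun x hx => by
    by_contra hu
    exact hx (hmax ▸ (IsLocalRing.mem_maximalIdeal x).2 hu)
  exact ⟨(IsLocalization.atUnits (P.Fiber α) (P.fiberMaxIdeal α).primeCompl
    (S := P.LocalFiber α) hunits).symm.toRingEquiv.trans E⟩

end HypersurfacePencil

/-! ### Comparison of Hilbert–Kunz multiplicities. -/

namespace HypersurfacePencil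

variable {k : Type*} [Field k] {n : ℕ} (P : HypersurfacePencil k n)

theorem member_at_zero : P.member 0 = P.f := by simp [member]

theorem hkSeq_member (p : ℕ) [Fact p.Prime] [CharP k p] (α : k) :
    hkSeq p (HypersurfaceRing (P.member α)) =
      fun e => ((P.member α).colength (p ^ e) : ℝ) / ((p : ℝ) ^ e) ^ (n - 1) :=
  HypersurfaceRing.hkSeq_eq p (P.member_ne_zero α) (P.member_zero α)

theorem hkSeq_f (p : ℕ) [Fact p.Prime] [CharP k p] :
    hkSeq p (HypersurfaceRing P.f) = hkSeq p (HypersurfaceRing (P.member 0)) := by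
  rw [hkSeq_member, HypersurfaceRing.hkSeq_eq p P.f_ne_zero P.f_zero, member_at_zero]

theorem hkSeq_localFiber (p : ℕ) (α : k) :
    hkSeq p (P.LocalFiber α) = hkSeq p (HypersurfaceRing (P.member α)) :=
  hkSeq_congr (P.exists_localFiberEquiv α).some p

theorem hkConverges_member (p : ℕ) [Fact p.Prime] [CharP k p] [PerfectRing k p] (α : k) :
    HKConverges p (HypersurfaceRing (P.member α)) := by
  rw [HKConverges, hkSeq_member]
  exact MvPowerSeries.exists_tendsto_colength_div p
    (MvPowerSeries.ne_zero_of_constantCoeff_eq_zero (P.member_ne_zero α) (P.member_zero α))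
    (P.member_ne_zero α)

theorem eHK_member_le (p : ℕ) [Fact p.Prime] [CharP k p] [PerfectRing k p] {α β : k}
    (h : ∀ e : ℕ, (P.member β).colength (p ^ e) ≤ (P.member α).colength (p ^ e)) :
    eHK p (HypersurfaceRing (P.member β)) ≤ eHK p (HypersurfaceRing (P.member α)) := by
  refine le_of_tendsto_of_tendsto' (tendsto_nhds_limUnder (P.hkConverges_member p β))
    (tendsto_nhds_limUnder (P.hkConverges_member p α)) fun e => ?_
  rw [hkSeq_member, hkSeq_member]
  dsimp only
  gcongr
  exact h e

/-- The parameters `β` such that all lengths for `f + β g` are at most those for `f + α g`. -/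
def specializationSet (p : ℕ) (α : k) : Set k :=
  {β | ∀ e : ℕ, (P.member β).colength (p ^ e) ≤ (P.member α).colength (p ^ e)}

theorem self_mem_specializationSet (p : ℕ) (α : k) : α ∈ P.specializationSet p α :=
  fun _ => le_rfl

/-- For each `e` only finitely many parameters violate the inequality, so the complement is a
countable union of finite sets. -/
theorem dense_specializationSet [Uncountable k] (p : ℕ) (α : k) :
    @Dense k (zariskiLine k) (P.specializationSet p α) := by
  refine dense_zariskiLine_of_countable_compl ?_
  refine (Set.countable_iUnion fun e : ℕ =>
    (MvPowerSeries.finite_setOf_colength_lt P.f P.g α (p ^ e)).countable).mono fun β hβ => ?_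
  obtain ⟨e, he⟩ := not_forall.1 hβ
  exact Set.mem_iUnion.2 ⟨e, not_le.1 he⟩

end HypersurfacePencil

end

theorem mainTheorem4 {p : ℕ} [Fact p.Prime] {k : Type*} [Field k] [CharP k p] [IsAlgClosed k]
    [Uncountable k] {n : ℕ} (P : HypersurfacePencil k n) :
    -- all Hilbert–Kunz multiplicities in question exist as limits
    (∀ α : k, HKConverges p (P.LocalFiber α) ∧ HKConverges p (HypersurfaceRing (P.member α))) ∧
    HKConverges p (HypersurfaceRing P.f) ∧
    -- the inequality on a dense set of parameters
    (∃ Λ : Set k, @Dense k (zariskiLine k) Λ ∧ 0 ∈ Λ ∧ ∀ α ∈ Λ,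
      eHK p (P.LocalFiber α) = eHK p (HypersurfaceRing (P.member α)) ∧
      eHK p (HypersurfaceRing (P.member α)) ≤ eHK p (P.LocalFiber 0) ∧
      eHK p (P.LocalFiber 0) = eHK p (HypersurfaceRing P.f)) ∧
    -- dense upper semicontinuity in the fibers over `k[t]`
    @DenseUpperSemicontinuous k (zariskiLine k) (fun α => eHK p (P.LocalFiber α)) := by
  -- The Cartier operators need `p`-th roots in `k`.
  have hperf : PerfectRing k p := PerfectField.toPerfectRing p
  have hfib : ∀ α, eHK p (P.LocalFiber α) = eHK p (HypersurfaceRing (P.member α)) := fun α => by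
    rw [eHK, eHK, P.hkSeq_localFiber]
  refine ⟨fun α => ⟨?_, P.hkConverges_member p α⟩, ?_, ?_, ?_⟩
  · rw [HKConverges, P.hkSeq_localFiber]
    exact P.hkConverges_member p α
  · rw [HKConverges, P.hkSeq_f]
    exact P.hkConverges_member p 0
  · refine ⟨P.specializationSet p 0, P.dense_specializationSet p 0,
      P.self_mem_specializationSet p 0, fun α hα => ⟨hfib α, ?_, ?_⟩⟩
    · rw [hfib]
      exact P.eHK_member_le p hα
    · rw [hfib, eHK, eHK, P.hkSeq_f]
  · intro α
    refine ⟨P.specializationSet p α, P.dense_specializationSet p α,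
      P.self_mem_specializationSet p α, fun β hβ => ?_⟩
    dsimp only
    rw [hfib, hfib]
    exact P.eHK_member_le p hβ
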